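/- For $n\in\mathbb{N}=\{0,1,2,\dots\}$ let $(n)_2$ denote the canonical base-$2$ representation of $n$ (most significant digit first, no leading zeros, so $(0)_2$ is the empty word), and let $S_>$ be the set of all $n\in\mathbb{N}$ such that $(n)_2$ contains strictly more $0$s than $1$s. Sums may have repeated summands, and the empty sum is $0$. (a) A natural number is a sum of at most three elements of $S_>$ if and only if it is not one of $$1, 2, 3, 5, 6, 7, 9, 10, 11, 13, 14, 15, 19, 23, 27, 31, 47, 63.$$ (b) The number $3$ is optimal: $3$ is the least $m$ such that every sufficiently large natural number is a sum of at most $m$ elements of $S_>$. In particular, infinitely many natural numbers are not a sum of at most two elements of $S_>$. (c) A natural number is a sum of at most three natural numbers whose base-$2$ representations lie in the regular language $L_4 = 10(01+10+0)^*0(01+10+0)^*$ if and only if it is not one of $$1, 2, 3, 5, 6, 7, 9, 10, 11, 13, 14, 15, 19, 23, 27, 31, 47, 63, 79.$$ -/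

import Mathlib

/-- The canonical base-2 representation `(n)_2` of `n`, most significant digit first, without
leading zeros; the representation of `0` is the empty word. -/
def binaryRep (n : ℕ) : List ℕ := (Nat.digits 2 n).reverse

/-- The set `S_>` of natural numbers with more `0`s than `1`s in base 2. -/
def moreZerosThanOnes : Set ℕ := {n | (binaryRep n).count 1 < (binaryRep n).count 0}

/-- `n` is a sum of at most `m` elements of `S`, repetitions allowed; the empty sum is `0`. -/
def IsSumOfAtMost (S : Set ℕ) (m n : ℕ) : Prop :=
  ∃ s : Multiset ℕ, s.card ≤ m ∧ (∀ x ∈ s, x ∈ S) ∧ s.sum = n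

/-- `S` is an asymptotic additive basis of order `m`: every sufficiently large natural number is
a sum of at most `m` elements of `S`. -/
def IsAsymptoticAdditiveBasis (S : Set ℕ) (m : ℕ) : Prop :=
  ∃ N : ℕ, ∀ n : ℕ, N ≤ n → IsSumOfAtMost S m n

open scoped Computability in
/-- The regular language `10(01+10+0)*0(01+10+0)*`. -/
def languageL4 : Language ℕ :=
  {[1, 0]} * ({[0, 1]} + {[1, 0]} + {[0]} : Language ℕ)∗ * {[0]} *
    ({[0, 1]} + {[1, 0]} + {[0]} : Language ℕ)∗

/-- The natural numbers whose base-2 representation lies in `languageL4`. -/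
def numbersL4 : Set ℕ := {n | binaryRep n ∈ languageL4}

/-!
If every `m` with `N ≤ m < 2 N` is of the form `x + y + 2 z` with `x`, `y`, `z` in a set closed
under `x ↦ 2 x` and `x ↦ 4 x + 1`, then so is every `n ≥ N`: halving `n` leads back to `m = n / 2`,
and `2 m = 2 x + 2 y + 2 (2 z)`, `2 m + 1 = (4 z + 1) + 2 x + 2 y`. The numbers with representation
in `L₄` have both closure properties, because appending a block `0` or `01` to a word of `L₄` gives
a word of `L₄`, and they lie in `S_>`. Taking `N = 80` leaves finitely many numbers to search.

Two summands are too few for `2 ^ k - 1`: adding them produces no carry, so their binary digits are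
complementary and contain `k` ones altogether, whereas an element of `S_>` below `2 ^ k` has fewer
than `k / 2` ones.
-/

open scoped Computability

section IsSumOfAtMost

variable {S T : Set ℕ} {m m' n n' : ℕ}

theorem IsSumOfAtMost.mono (hm : m ≤ m') (h : IsSumOfAtMost S m n) : IsSumOfAtMost S m' n :=
  let ⟨s, hcard, hmem, hsum⟩ := h
  ⟨s, hcard.trans hm, hmem, hsum⟩

theorem IsSumOfAtMost.mono_set (hST : S ⊆ T) (h : IsSumOfAtMost S m n) : IsSumOfAtMost T m n :=
  let ⟨s, hcard, hmem, hsum⟩ := h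
  ⟨s, hcard, fun x hx => hST (hmem x hx), hsum⟩

theorem IsSumOfAtMost.add (h : IsSumOfAtMost S m n) (h' : IsSumOfAtMost S m' n') :
    IsSumOfAtMost S (m + m') (n + n') := by
  obtain ⟨s, hcard, hmem, rfl⟩ := h
  obtain ⟨s', hcard', hmem', rfl⟩ := h'
  refine ⟨s + s', ?_, fun x hx => ?_, Multiset.sum_add s s'⟩
  · simpa only [Multiset.card_add] using add_le_add hcard hcard'
  · exact (Multiset.mem_add.mp hx).elim (hmem x) (hmem' x)

theorem isSumOfAtMost_zero_right : IsSumOfAtMost S m 0 :=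
  ⟨0, by simp⟩

theorem IsSumOfAtMost.of_mem (hn : n ∈ S) : IsSumOfAtMost S 1 n :=
  ⟨{n}, by simpa⟩

theorem isSumOfAtMost_zero_left_iff : IsSumOfAtMost S 0 n ↔ n = 0 := by
  simp [IsSumOfAtMost, eq_comm]

theorem isSumOfAtMost_succ_iff :
    IsSumOfAtMost S (m + 1) n ↔ ∃ x ≤ n, x ∈ insert 0 S ∧ IsSumOfAtMost S m (n - x) := by
  constructor
  · rintro ⟨s, hcard, hmem, rfl⟩
    induction s using Multiset.induction_on with
    | empty => exact ⟨0, by simpa using isSumOfAtMost_zero_right⟩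
    | cons x s _ =>
      rw [Multiset.forall_mem_cons] at hmem
      rw [Multiset.card_cons, add_le_add_iff_right] at hcard
      rw [Multiset.sum_cons]
      exact ⟨x, Nat.le_add_right _ _, Or.inr hmem.1, s, hcard, hmem.2, by simp⟩
  · rintro ⟨x, hxn, rfl | hx, h⟩
    · exact h.mono m.le_succ
    · simpa only [Nat.sub_add_cancel hxn] using h.add (.of_mem hx)

theorem isSumOfAtMost_one_iff : IsSumOfAtMost S 1 n ↔ n ∈ insert 0 S := by
  constructor
  · rw [isSumOfAtMost_succ_iff]
    rintro ⟨x, hxn, hx, h⟩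
    rwa [le_antisymm (Nat.sub_eq_zero_iff_le.mp (isSumOfAtMost_zero_left_iff.mp h)) hxn]
  · rintro (rfl | hn)
    exacts [isSumOfAtMost_zero_right, .of_mem hn]

instance IsSumOfAtMost.instDecidable (S : Set ℕ) [DecidablePred (· ∈ S)] :
    ∀ m n, Decidable (IsSumOfAtMost S m n)
  | 0, _ => decidable_of_iff' _ isSumOfAtMost_zero_left_iff
  -- A direct test of `n ∈ insert 0 S` spares the last level of the search a scan of all `x ≤ n`.
  | 1, _ => decidable_of_iff' _ isSumOfAtMost_one_iff
  | m + 2, _ =>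
    have := instDecidable S (m + 1)
    decidable_of_iff' _ isSumOfAtMost_succ_iff

theorem IsAsymptoticAdditiveBasis.mono (hm : m ≤ m') (h : IsAsymptoticAdditiveBasis S m) :
    IsAsymptoticAdditiveBasis S m' :=
  h.imp fun _ hN n hn => (hN n hn).mono hm

end IsSumOfAtMost

theorem exists_add_add_two_mul_eq {S : Set ℕ} {N n : ℕ} (hN : 0 < N)
    (two_mul_mem : ∀ x ∈ S, 2 * x ∈ S) (four_mul_add_one_mem : ∀ x ∈ S, 4 * x + 1 ∈ S)
    (base : ∀ m ∈ Set.Ico N (2 * N), ∃ x ∈ S, ∃ y ∈ S, ∃ z ∈ S, x + y + 2 * z = m) (hn : N ≤ n) :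
    ∃ x ∈ S, ∃ y ∈ S, ∃ z ∈ S, x + y + 2 * z = n := by
  induction n using Nat.strong_induction_on with
  | _ n ih =>
    rcases lt_or_ge n (2 * N) with hlt | hge
    · exact base n ⟨hn, hlt⟩
    obtain ⟨x, hx, y, hy, z, hz, hsum⟩ := ih (n / 2) (by omega) (by omega)
    rcases n.mod_two_eq_zero_or_one with heven | hodd
    · exact ⟨2 * x, two_mul_mem x hx, 2 * y, two_mul_mem y hy, 2 * z, two_mul_mem z hz, by omega⟩
    · exact ⟨4 * z + 1, four_mul_add_one_mem z hz, 2 * x, two_mul_mem x hx, y, hy, by omega⟩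

section DigitSum

theorem sum_digits_eq_mod_add_sum_digits_div {b : ℕ} (hb : 1 < b) (n : ℕ) :
    (b.digits n).sum = n % b + (b.digits (n / b)).sum := by
  rcases n.eq_zero_or_pos with rfl | hn
  · simp
  · rw [Nat.digits_def' hb hn, List.sum_cons]

theorem sum_digits_add_sum_digits {b k x y : ℕ} (hb : 1 < b) (h : x + y + 1 = b ^ k) :
    (b.digits x).sum + (b.digits y).sum = k * (b - 1) := by
  induction k generalizing x y with
  | zero =>
    obtain ⟨rfl, rfl⟩ : x = 0 ∧ y = 0 := by rw [pow_zero] at h; omega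
    simp
  | succ k ih =>
    have hsplit : b * (x / b + y / b) + (x % b + y % b + 1) = b * b ^ k := by
      rw [← pow_succ', ← h, mul_add]
      have := Nat.div_add_mod x b
      have := Nat.div_add_mod y b
      omega
    have hmod : x % b + y % b + 1 = b := by
      have hdvd : b ∣ x % b + y % b + 1 :=
        (Nat.dvd_add_right (dvd_mul_right b _)).mp (hsplit ▸ dvd_mul_right b _)
      have hx := Nat.mod_lt x (zero_lt_one.trans hb)
      have hy := Nat.mod_lt y (zero_lt_one.trans hb)
      exact Nat.eq_of_dvd_of_lt_two_mul (Nat.succ_ne_zero _) hdvd (by omega)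
    have hdiv : x / b + y / b + 1 = b ^ k := by
      rw [hmod, ← mul_add_one] at hsplit
      exact Nat.eq_of_mul_eq_mul_left (zero_lt_one.trans hb) hsplit
    rw [sum_digits_eq_mod_add_sum_digits_div hb x, sum_digits_eq_mod_add_sum_digits_div hb y,
      add_one_mul, ← ih hdiv]
    omega

theorem sum_eq_count_one {l : List ℕ} (hl : ∀ d ∈ l, d < 2) : l.sum = l.count 1 := by
  induction l with
  | nil => rfl
  | cons d l ih =>
    rw [List.forall_mem_cons] at hl
    rw [List.sum_cons, List.count_cons, ih hl.2]
    have := hl.1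
    interval_cases d <;> simp [add_comm]

theorem count_add_count_le_length {α : Type*} [DecidableEq α] {a b : α} (hab : a ≠ b)
    (l : List α) : l.count a + l.count b ≤ l.length := by
  induction l with
  | nil => rfl
  | cons c l ih => grind

end DigitSum

section MoreZerosThanOnes

instance : DecidablePred (· ∈ moreZerosThanOnes) :=
  fun n => inferInstanceAs (Decidable ((binaryRep n).count 1 < (binaryRep n).count 0))

theorem two_mul_sum_digits_lt_of_mem {k n : ℕ} (hk : 0 < k) (hn : n ∈ insert 0 moreZerosThanOnes)
    (hlt : n < 2 ^ k) : 2 * (Nat.digits 2 n).sum < k := by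
  rcases hn with rfl | hn
  · simpa using hk
  have hcount : (Nat.digits 2 n).count 1 < (Nat.digits 2 n).count 0 := by
    simpa only [binaryRep, List.count_reverse] using Set.mem_ofPred.mp hn
  have hlength := (Nat.digits_length_le_iff one_lt_two n).mpr hlt
  have := count_add_count_le_length zero_ne_one (Nat.digits 2 n)
  rw [sum_eq_count_one fun d hd => Nat.digits_lt_base one_lt_two hd]
  omega

theorem not_isSumOfAtMost_two_two_pow_sub_one {k : ℕ} (hk : 0 < k) :
    ¬ IsSumOfAtMost moreZerosThanOnes 2 (2 ^ k - 1) := by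
  simp only [isSumOfAtMost_succ_iff (m := 1), isSumOfAtMost_one_iff]
  rintro ⟨x, hx_le, hx, hy⟩
  have hpos : 0 < 2 ^ k := by positivity
  have hsum := sum_digits_add_sum_digits (k := k) one_lt_two
    (x := x) (y := 2 ^ k - 1 - x) (by omega)
  have := two_mul_sum_digits_lt_of_mem hk hx (by omega)
  have := two_mul_sum_digits_lt_of_mem hk hy (by omega)
  omega

theorem not_isAsymptoticAdditiveBasis_moreZerosThanOnes_two :
    ¬ IsAsymptoticAdditiveBasis moreZerosThanOnes 2 := by
  rintro ⟨N, hN⟩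
  have hlt : N + 1 < 2 ^ (N + 1) := Nat.lt_two_pow_self
  exact not_isSumOfAtMost_two_two_pow_sub_one N.succ_pos (hN _ (by omega))

end MoreZerosThanOnes

section LanguageL4

theorem singleton_append_eq_mul {α : Type*} (u v : List α) :
    ({u ++ v} : Language α) = {u} * {v} :=
  Set.image2_singleton.symm

theorem count_le_count_of_mem_kstar {α : Type*} [DecidableEq α] {l : Language α} {a b : α}
    (hl : ∀ w ∈ l, w.count a ≤ w.count b) {w : List α} (hw : w ∈ l∗) : w.count a ≤ w.count b := by
  obtain ⟨L, rfl, hL⟩ := Language.mem_kstar.mp hw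
  rw [List.count_flatten, List.count_flatten]
  exact List.sum_le_sum fun w hw => hl w (hL w hw)

/-- The language `{01, 10, 0}` whose Kleene star occurs twice in `languageL4`. -/
def blocksL4 : Language ℕ := {[0, 1]} + {[1, 0]} + {[0]}

theorem mem_blocksL4 {w : List ℕ} : w ∈ blocksL4 ↔ w = [0, 1] ∨ w = [1, 0] ∨ w = [0] := by
  simp only [blocksL4, Language.mem_add, or_assoc]
  rfl

theorem languageL4_mul_blocksL4_le : languageL4 * blocksL4 ≤ languageL4 := by
  change _ * blocksL4∗ * blocksL4 ≤ _ * blocksL4∗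
  rw [mul_assoc]
  gcongr
  exact kstar_mul_le_kstar

theorem count_one_lt_count_zero_of_mem_languageL4 {w : List ℕ} (hw : w ∈ languageL4) :
    w.count 1 < w.count 0 := by
  obtain ⟨_, ⟨_, ⟨_, rfl, u, hu, rfl⟩, _, rfl, rfl⟩, v, hv, rfl⟩ := hw
  have hblocks : ∀ w ∈ blocksL4, w.count 1 ≤ w.count 0 := by
    intro w hw
    rcases mem_blocksL4.mp hw with rfl | rfl | rfl <;> decide
  have hu' := count_le_count_of_mem_kstar hblocks hu
  have hv' := count_le_count_of_mem_kstar hblocks hv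
  grind

theorem numbersL4_subset_moreZerosThanOnes : numbersL4 ⊆ moreZerosThanOnes :=
  fun _ => count_one_lt_count_zero_of_mem_languageL4

open RegularExpression (char) in
/-- A regular expression for `languageL4`, used to decide membership by matching. -/
def regularExpressionL4 : RegularExpression ℕ :=
  let blocks := char 0 * char 1 + char 1 * char 0 + char 0
  char 1 * char 0 * blocks.star * char 0 * blocks.star

theorem matches'_regularExpressionL4 : regularExpressionL4.matches' = languageL4 := by
  simp only [regularExpressionL4, RegularExpression.matches'_mul, RegularExpression.matches'_add,
    RegularExpression.matches'_star, RegularExpression.matches'_char,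
    ← singleton_append_eq_mul, List.singleton_append]
  rfl

instance : DecidablePred (· ∈ numbersL4) := fun n =>
  decidable_of_iff (binaryRep n ∈ regularExpressionL4.matches')
    (by rw [matches'_regularExpressionL4]; rfl)

theorem binaryRep_two_mul_add {b n : ℕ} (hb : b < 2) (hn : n ≠ 0) :
    binaryRep (2 * n + b) = binaryRep n ++ [b] := by
  rw [binaryRep, add_comm, Nat.digits_add 2 one_lt_two b n hb (Or.inr hn), List.reverse_cons,
    binaryRep]

theorem zero_notMem_numbersL4 : 0 ∉ numbersL4 := by
  decide

theorem two_mul_mem_numbersL4 {n : ℕ} (hn : n ∈ numbersL4) : 2 * n ∈ numbersL4 := by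
  have hn0 := ne_of_mem_of_not_mem hn zero_notMem_numbersL4
  have hrep : binaryRep (2 * n) = binaryRep n ++ [0] := binaryRep_two_mul_add two_pos hn0
  apply languageL4_mul_blocksL4_le
  rw [hrep]
  exact Language.append_mem_mul hn (mem_blocksL4.mpr (by simp))

theorem four_mul_add_one_mem_numbersL4 {n : ℕ} (hn : n ∈ numbersL4) : 4 * n + 1 ∈ numbersL4 := by
  have hn0 := ne_of_mem_of_not_mem hn zero_notMem_numbersL4
  have hrep : binaryRep (4 * n + 1) = binaryRep n ++ [0, 1] := by
    calc binaryRep (4 * n + 1) = binaryRep (2 * (2 * n + 0) + 1) := by ring_nf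
      _ = binaryRep n ++ [0] ++ [1] := by
        rw [binaryRep_two_mul_add one_lt_two (by omega), binaryRep_two_mul_add two_pos hn0]
      _ = binaryRep n ++ [0, 1] := by simp
  apply languageL4_mul_blocksL4_le
  rw [hrep]
  exact Language.append_mem_mul hn (mem_blocksL4.mpr (by simp))

theorem exists_numbersL4_add_add_two_mul_eq_of_mem_Ico {n : ℕ} (hn : n ∈ Set.Ico 80 160) :
    ∃ x ∈ numbersL4, ∃ y ∈ numbersL4, ∃ z ∈ numbersL4, x + y + 2 * z = n := by
  have hmem : ∀ x ∈ [4, 8, 16, 17, 18, 20, 33, 40, 69, 70], x ∈ numbersL4 := by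
    decide +kernel
  have hsum : ∀ n < 160, 80 ≤ n → ∃ x ∈ [4, 8, 16, 17, 18, 20, 33, 40, 69, 70],
      ∃ y ∈ [4, 8, 16, 17, 18, 20, 33, 40, 69, 70],
      ∃ z ∈ [4, 8, 16, 17, 18, 20, 33, 40, 69, 70], x + y + 2 * z = n := by
    decide +kernel
  obtain ⟨x, hx, y, hy, z, hz, hn⟩ := hsum n hn.2 hn.1
  exact ⟨x, hmem x hx, y, hmem y hy, z, hmem z hz, hn⟩

theorem isSumOfAtMost_numbersL4_three_of_le {n : ℕ} (hn : 80 ≤ n) :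
    IsSumOfAtMost numbersL4 3 n := by
  obtain ⟨x, hx, y, hy, z, hz, rfl⟩ := exists_add_add_two_mul_eq (by norm_num)
    (fun _ => two_mul_mem_numbersL4) (fun _ => four_mul_add_one_mem_numbersL4)
    (fun _ => exists_numbersL4_add_add_two_mul_eq_of_mem_Ico) hn
  exact ((IsSumOfAtMost.of_mem hx).add (.of_mem hy)).add (.of_mem (two_mul_mem_numbersL4 hz))

theorem isSumOfAtMost_numbersL4_three_iff (n : ℕ) :
    IsSumOfAtMost numbersL4 3 n ↔
      n ∉ ({1, 2, 3, 5, 6, 7, 9, 10, 11, 13, 14, 15, 19, 23, 27, 31, 47, 63, 79} : Set ℕ) := by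
  rcases lt_or_ge n 80 with hlt | hge
  · revert n
    decide +kernel
  · refine iff_of_true (isSumOfAtMost_numbersL4_three_of_le hge) ?_
    simp only [Set.mem_insert_iff, Set.mem_singleton_iff]
    omega

theorem isSumOfAtMost_moreZerosThanOnes_three_iff (n : ℕ) :
    IsSumOfAtMost moreZerosThanOnes 3 n ↔
      n ∉ ({1, 2, 3, 5, 6, 7, 9, 10, 11, 13, 14, 15, 19, 23, 27, 31, 47, 63} : Set ℕ) := by
  rcases lt_or_ge n 80 with hlt | hge
  · revert n
    decide +kernel
  · refine iff_of_true ((isSumOfAtMost_numbersL4_three_of_le hge).mono_set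
      numbersL4_subset_moreZerosThanOnes) ?_
    simp only [Set.mem_insert_iff, Set.mem_singleton_iff]
    omega

end LanguageL4

theorem isAsymptoticAdditiveBasis_moreZerosThanOnes_three :
    IsAsymptoticAdditiveBasis moreZerosThanOnes 3 :=
  ⟨80, fun _ hn => (isSumOfAtMost_numbersL4_three_of_le hn).mono_set
    numbersL4_subset_moreZerosThanOnes⟩

theorem mainTheorem6 :
    (∀ n : ℕ, IsSumOfAtMost moreZerosThanOnes 3 n ↔
      n ∉ ({1, 2, 3, 5, 6, 7, 9, 10, 11, 13, 14, 15, 19, 23, 27, 31, 47, 63} : Set ℕ)) ∧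
    IsLeast {m : ℕ | IsAsymptoticAdditiveBasis moreZerosThanOnes m} 3 ∧
    (∀ n : ℕ, IsSumOfAtMost numbersL4 3 n ↔
      n ∉ ({1, 2, 3, 5, 6, 7, 9, 10, 11, 13, 14, 15, 19, 23, 27, 31, 47, 63, 79} : Set ℕ)) := by
  refine ⟨isSumOfAtMost_moreZerosThanOnes_three_iff,
    ⟨isAsymptoticAdditiveBasis_moreZerosThanOnes_three, fun m hm => ?_⟩,
    isSumOfAtMost_numbersL4_three_iff⟩
  by_contra! hlt
  exact not_isAsymptoticAdditiveBasis_moreZerosThanOnes_two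
    (IsAsymptoticAdditiveBasis.mono (Nat.le_of_lt_succ hlt) hm)
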